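/- Algebras are unital and over $\mathbb C$. Let $C$ be a $*$-algebra and let $(A,\varphi)$ be a noncommutative probability space, i.e. $A$ is a $*$-algebra and $\varphi:A\to\mathbb C$ is a state (linear, $\varphi(1)=1$, $\varphi(a^*a)\ge 0$). Let $\rho_1,\dots,\rho_n:C\to A$ be unital $*$-homomorphisms, and let $\rho=\rho_1*\cdots*\rho_n:C_n\to A$ be the induced homomorphism, where $C_n$ is the free product (over $\mathbb C$) of $n$ copies of $C$ and $c^{(i)}\in C_n$ denotes the copy of $c\in C$ in the $i$-th factor. Let $B\subset A$ be a unital $*$-subalgebra and let $E:A\to B$ be a conditional expectation, i.e. a linear map with $E[1]=1$ and $E[b_1ab_2]=b_1E[a]b_2$ for all $a\in A$, $b_1,b_2\in B$. Suppose that $\varphi\circ E=\varphi$. For each $i$ let $\widetilde\rho_i=\rho_i*\mathrm{id}_B:C*B\to A$. Suppose that (a) $(\rho_1,\dots,\rho_n)$ is identically distributed with respect to $E$: $E\circ\widetilde\rho_i=E\circ\widetilde\rho_j$ for all $i,j$; and (b) $(\rho_1,\dots,\rho_n)$ is freely independent with respect to $E$: $E[\widetilde\rho_{i_1}(\beta_1)\cdots\widetilde\rho_{i_k}(\beta_k)]=0$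 whenever $k\ge1$, $i_l\ne i_{l+1}$ for $1\le l<k$, and $\beta_1,\dots,\beta_k\in C*B$ satisfy $E[\widetilde\rho_{i_l}(\beta_l)]=0$ for $1\le l\le k$. Then $(\rho_1,\dots,\rho_n)$ is quantum exchangeable, in the following sense. Let $A_s(n)$ be the universal unital C$^*$-algebra generated by the entries $u_{ij}$ of an $n\times n$ magic unitary (every $u_{ij}$ is a projection, distinct entries in the same row or the same column have product $0$, and every row and every column sums to $1$), let $\mathcal A_s(n)\subset A_s(n)$ be the $*$-subalgebra generated by the $u_{ij}$, and let $\alpha_n:C_n\to C_n\otimes\mathcal A_s(n)$ be the unital homomorphism determined by $\alpha_n(c^{(j)})=\sum_{i=1}^n c^{(i)}\otimes u_{ij}$ for $c\in C$, $1\le j\le n$. Then, with $\varphi_\rho=\varphi\circ\rho$, $$(\varphi_\rho\otimes\mathrm{id})\,\alpha_n(p)=\varphi_\rho(p)\,1_{A_s(n)}\qquad\text{for all }p\in C_n .$$ -/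

import Mathlib

open scoped TensorProduct ENNReal ComplexOrder CStarAlgebra

universe u v w

noncomputable section

namespace QuantumPerm

/-! ### Magic unitaries and the quantum permutation group -/

/-- An `n × n` matrix over a `*`-ring is a *magic unitary* if its entries are projections, distinct
entries in the same row or column are orthogonal, and each row and each column sums to `1`. -/
structure IsMagicUnitary {n : ℕ} {D : Type*} [Ring D] [StarRing D]
    (m : Fin n → Fin n → D) : Prop where
  proj : ∀ i j, IsStarProjection (m i j)
  row_orth : ∀ i k l, k ≠ l → m i k * m i l = 0
  col_orth : ∀ j k l, k ≠ l → m k j * m l j = 0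
  row_sum : ∀ i, ∑ k, m i k = 1
  col_sum : ∀ j, ∑ k, m k j = 1

/-- A nonzero unital C⋆-algebra with a magic unitary in it. -/
structure MagicModel (n : ℕ) : Type (v + 1) where
  carrier : Type v
  [cstar : CStarAlgebra carrier]
  [nontriv : Nontrivial carrier]
  mat : Fin n → Fin n → carrier
  magic : IsMagicUnitary mat

attribute [instance] MagicModel.cstar MagicModel.nontriv

/-- The C⋆-algebra of bounded families `(d_M)` indexed by all models `M`, with `d_M` in the
C⋆-algebra of `M`. -/
abbrev ModelProduct (n : ℕ) : Type (v + 1) :=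
  lp (fun M : MagicModel.{v} n => M.carrier) ∞

instance (n : ℕ) : CStarAlgebra (ModelProduct.{v} n) where

lemma norm_le_one_of_proj {D : Type*} [CStarAlgebra D] {p : D} (hp : IsStarProjection p) :
    ‖p‖ ≤ 1 := by
  have h : ‖p‖ = ‖p‖ * ‖p‖ := by
    have h1 := CStarRing.norm_star_mul_self (x := p)
    rwa [hp.isSelfAdjoint.star_eq, hp.isIdempotentElem.eq] at h1
  nlinarith [norm_nonneg p]

/-- The family of the `(i, j)` entries of the magic unitaries of all models. -/
def modelEntry (n : ℕ) (i j : Fin n) : ModelProduct.{v} n :=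
  ⟨fun M => M.mat i j, memℓp_infty ⟨1, by
    rintro _ ⟨M, rfl⟩
    exact norm_le_one_of_proj (M.magic.proj i j)⟩⟩

/-- The quantum permutation group `A_s(n)`: the universal unital C⋆-algebra generated by the entries
of an `n × n` magic unitary. It is built as the closed `*`-subalgebra generated by the entries of
all models (taken at once); see `QuantumPerm.existsUnique_lift` for its universal property. -/
def AsSubalgebra (n : ℕ) : StarSubalgebra ℂ (ModelProduct.{v} n) :=
  (StarAlgebra.adjoin ℂ
    (Set.range fun p : Fin n × Fin n => modelEntry.{v} n p.1 p.2)).topologicalClosure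

/-- `A_s(n)` as a type. -/
def As (n : ℕ) : Type (v + 1) := AsSubalgebra.{v} n

instance (n : ℕ) : IsClosed (AsSubalgebra.{v} n : Set (ModelProduct.{v} n)) :=
  StarSubalgebra.isClosed_topologicalClosure _

instance (n : ℕ) : CStarAlgebra (As.{v} n) :=
  inferInstanceAs (CStarAlgebra (AsSubalgebra.{v} n))

/-- The inclusion of `A_s(n)` in the product of all models. -/
def As.incl (n : ℕ) : As.{v} n →⋆ₐ[ℂ] ModelProduct.{v} n :=
  (AsSubalgebra.{v} n).subtype

/-- The generators `u_{ij}` of `A_s(n)`. -/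
def gen (n : ℕ) : Fin n → Fin n → As.{v} n := fun i j =>
  ⟨modelEntry n i j, StarSubalgebra.le_topologicalClosure _
    (StarAlgebra.subset_adjoin ℂ _ ⟨(i, j), rfl⟩)⟩

/-- The canonical dense `*`-subalgebra of `A_s(n)`, generated by the `u_{ij}`. -/
def denseAlg (n : ℕ) : StarSubalgebra ℂ (As.{v} n) :=
  StarAlgebra.adjoin ℂ (Set.range fun p : Fin n × Fin n => gen.{v} n p.1 p.2)

/-- The generators `u_{ij}`, as elements of the canonical dense `*`-subalgebra. -/
def denseGen (n : ℕ) : Fin n → Fin n → denseAlg.{v} n := fun i j =>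
  ⟨gen n i j, StarAlgebra.subset_adjoin ℂ _ ⟨(i, j), rfl⟩⟩

/-- Evaluation at a model. -/
def evalModel {n : ℕ} (M : MagicModel.{v} n) : ModelProduct.{v} n →⋆ₐ[ℂ] M.carrier where
  toFun x := x M
  map_one' := rfl
  map_mul' _ _ := rfl
  map_zero' := rfl
  map_add' _ _ := rfl
  commutes' _ := rfl
  map_star' _ := rfl

lemma gen_magic (n : ℕ) : IsMagicUnitary (gen.{v} n) where
  proj i j := by
    refine ⟨?_, ?_⟩
    · refine Subtype.ext (lp.ext (funext fun M => ?_))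
      exact (M.magic.proj i j).isIdempotentElem
    · refine Subtype.ext (lp.ext (funext fun M => ?_))
      exact (M.magic.proj i j).isSelfAdjoint
  row_orth i k l h := by
    refine Subtype.ext (lp.ext (funext fun M => ?_))
    exact M.magic.row_orth i k l h
  col_orth j k l h := by
    refine Subtype.ext (lp.ext (funext fun M => ?_))
    exact M.magic.col_orth j k l h
  row_sum i := by
    refine Subtype.ext (lp.ext (funext fun M => ?_))
    have := map_sum ((evalModel M).comp (As.incl n)) (fun k => gen n i k) Finset.univ
    exact this.trans (M.magic.row_sum i)
  col_sum j := by
    refine Subtype.ext (lp.ext (funext fun M => ?_))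
    have := map_sum ((evalModel M).comp (As.incl n)) (fun k => gen n k j) Finset.univ
    exact this.trans (M.magic.col_sum j)

lemma denseGen_magic (n : ℕ) : IsMagicUnitary (denseGen.{v} n) where
  proj i j := ⟨Subtype.ext ((gen_magic n).proj i j).isIdempotentElem,
    Subtype.ext ((gen_magic n).proj i j).isSelfAdjoint⟩
  row_orth i k l h := Subtype.ext ((gen_magic n).row_orth i k l h)
  col_orth j k l h := Subtype.ext ((gen_magic n).col_orth j k l h)
  row_sum i := Subtype.ext <| by
    have := map_sum (denseAlg.{v} n).subtype (fun k => denseGen n i k) Finset.univ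
    exact this.trans ((gen_magic n).row_sum i)
  col_sum j := Subtype.ext <| by
    have := map_sum (denseAlg.{v} n).subtype (fun k => denseGen n k j) Finset.univ
    exact this.trans ((gen_magic n).col_sum j)

/-- The universal property of `A_s(n)`: any magic unitary in a unital C⋆-algebra `D` is the image of
`(u_{ij})` under a unique unital `*`-homomorphism `A_s(n) → D`. -/
theorem existsUnique_lift {n : ℕ} {D : Type v} [CStarAlgebra D] (m : Fin n → Fin n → D)
    (hm : IsMagicUnitary m) :
    ∃! f : As.{v} n →⋆ₐ[ℂ] D, ∀ i j, f (gen.{v} n i j) = m i j := by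
  rcases subsingleton_or_nontrivial D with hD | hD
  · refine ⟨{ toFun := fun _ => 0, map_one' := Subsingleton.elim _ _,
              map_mul' := fun _ _ => Subsingleton.elim _ _, map_zero' := rfl,
              map_add' := fun _ _ => Subsingleton.elim _ _,
              commutes' := fun _ => Subsingleton.elim _ _,
              map_star' := fun _ => Subsingleton.elim _ _ },
      fun _ _ => Subsingleton.elim _ _, fun g _ => ?_⟩
    ext x
    exact Subsingleton.elim _ _
  · refine ⟨(evalModel ⟨D, m, hm⟩).comp (As.incl n), fun _ _ => rfl,
      fun g hg => ?_⟩
    have h₁ : Continuous g := map_continuous (F := As.{v} n →⋆ₐ[ℂ] D) g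
    have h₂ : Continuous ((evalModel ⟨D, m, hm⟩).comp (As.incl n)) :=
      map_continuous (F := As.{v} n →⋆ₐ[ℂ] D) _
    refine StarAlgHom.ext_topologicalClosure h₁ h₂ ?_
    · refine StarAlgHom.ext_adjoin ?_
      rintro ⟨_, _⟩ ⟨⟨i, j⟩, rfl⟩
      exact hg i j

/-! ### Free products and the coaction of the quantum permutation group -/

section Coaction

variable (C : Type u) [Ring C] [Algebra ℂ C]

/-- `C_n`, the free product with amalgamation over `ℂ` of `n` copies of `C`. -/
abbrev FreePower (n : ℕ) : Type u := LinearAlgebra.FreeProduct ℂ (fun _ : Fin n => C)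

variable {C}

/-- The canonical map `c ↦ c^{(i)}` of `C` onto the `i`-th copy of `C` in `C_n`. -/
abbrev copy {n : ℕ} (i : Fin n) : C →ₐ[ℂ] FreePower C n :=
  LinearAlgebra.FreeProduct.ι ℂ (fun _ : Fin n => C) i

/-- `c ↦ ∑ i, c^{(i)} ⊗ u_{ij}`. -/
def coactionAux (n : ℕ) (j : Fin n) : C →ₐ[ℂ] FreePower C n ⊗[ℂ] denseAlg.{v} n :=
  AlgHom.ofLinearMap
    (∑ i, ((TensorProduct.mk ℂ (FreePower C n) (denseAlg.{v} n)).flip (denseGen n i j)) ∘ₗ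
      (copy i).toLinearMap)
    (by
      simp only [LinearMap.sum_apply, LinearMap.comp_apply, AlgHom.toLinearMap_apply, map_one,
        LinearMap.flip_apply, TensorProduct.mk_apply]
      rw [← TensorProduct.tmul_sum, (denseGen_magic n).col_sum j]
      rfl)
    (by
      intro a b
      simp only [LinearMap.sum_apply, LinearMap.comp_apply, AlgHom.toLinearMap_apply, map_mul,
        LinearMap.flip_apply, TensorProduct.mk_apply, Finset.sum_mul, Finset.mul_sum,
        Algebra.TensorProduct.tmul_mul_tmul]
      refine Finset.sum_congr rfl fun i _ => ?_
      rw [Finset.sum_eq_single i]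
      · rw [((denseGen_magic n).proj i j).isIdempotentElem.eq]
      · intro k _ hk
        rw [(denseGen_magic n).col_orth j k i hk, TensorProduct.tmul_zero]
      · simp)

/-- The coaction `α_n : C_n → C_n ⊗ 𝒜_s(n)`, determined by
`α_n (c^{(j)}) = ∑ i, c^{(i)} ⊗ u_{ij}`. -/
def coaction (n : ℕ) : FreePower C n →ₐ[ℂ] FreePower C n ⊗[ℂ] denseAlg.{v} n :=
  LinearAlgebra.FreeProduct.lift ℂ (fun _ : Fin n => C) (fun {j} => coactionAux n j)

theorem coaction_copy (n : ℕ) (j : Fin n) (c : C) :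
    coaction.{u, v} n (copy j c) = ∑ i, copy i c ⊗ₜ[ℂ] denseGen.{v} n i j := by
  have h := DFunLike.congr_fun (LinearAlgebra.FreeProduct.lift_comp_ι ℂ (fun _ : Fin n => C)
    (fun {j} => coactionAux.{u, v} (C := C) n j) (i := j)) c
  refine h.trans ?_
  simp [coactionAux]

/-- The map `ψ ⊗ id : C_n ⊗ 𝒜_s(n) → 𝒜_s(n)` for a functional `ψ` on `C_n`. -/
def slice {n : ℕ} (ψ : FreePower C n →ₗ[ℂ] ℂ) :
    FreePower C n ⊗[ℂ] denseAlg.{v} n →ₗ[ℂ] denseAlg.{v} n :=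
  (TensorProduct.lid ℂ (denseAlg.{v} n)).toLinearMap ∘ₗ ψ.rTensor (denseAlg.{v} n)

theorem slice_tmul {n : ℕ} (ψ : FreePower C n →ₗ[ℂ] ℂ) (p : FreePower C n)
    (a : denseAlg.{v} n) : slice ψ (p ⊗ₜ[ℂ] a) = ψ p • a := by
  simp [slice]

end Coaction

/-! ### Noncommutative probability -/

/-- A state on a unital `*`-algebra. -/
structure IsState {A : Type*} [Ring A] [StarRing A] [Algebra ℂ A] (φ : A →ₗ[ℂ] ℂ) : Prop where
  map_one : φ 1 = 1
  nonneg : ∀ a, 0 ≤ φ (star a * a)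

/-- A linear map `E : A → B` onto a unital `*`-subalgebra is a conditional expectation if
`E 1 = 1` and `E (b₁ a b₂) = b₁ (E a) b₂`. -/
structure IsCondExp {A : Type*} [Ring A] [StarRing A] [Algebra ℂ A] [StarModule ℂ A]
    (B : StarSubalgebra ℂ A) (E : A →ₗ[ℂ] B) : Prop where
  map_one : E 1 = 1
  bimodule : ∀ (b₁ b₂ : B) (a : A), E (b₁ * a * b₂) = b₁ * E a * b₂

section FreeProd

variable (C : Type u) [Ring C] [Algebra ℂ C] (B : Type w) [Ring B] [Algebra ℂ B]

/-- The relations making the two families of generators unital `ℂ`-algebra homomorphisms. -/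
inductive FreeProdRel : FreeAlgebra ℂ (C ⊕ B) → FreeAlgebra ℂ (C ⊕ B) → Prop
  | add_left (a b : C) : FreeProdRel (FreeAlgebra.ι ℂ (Sum.inl (a + b)))
      (FreeAlgebra.ι ℂ (Sum.inl a) + FreeAlgebra.ι ℂ (Sum.inl b))
  | mul_left (a b : C) : FreeProdRel (FreeAlgebra.ι ℂ (Sum.inl (a * b)))
      (FreeAlgebra.ι ℂ (Sum.inl a) * FreeAlgebra.ι ℂ (Sum.inl b))
  | scalar_left (z : ℂ) : FreeProdRel (FreeAlgebra.ι ℂ (Sum.inl (algebraMap ℂ C z)))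
      (algebraMap ℂ _ z)
  | add_right (a b : B) : FreeProdRel (FreeAlgebra.ι ℂ (Sum.inr (a + b)))
      (FreeAlgebra.ι ℂ (Sum.inr a) + FreeAlgebra.ι ℂ (Sum.inr b))
  | mul_right (a b : B) : FreeProdRel (FreeAlgebra.ι ℂ (Sum.inr (a * b)))
      (FreeAlgebra.ι ℂ (Sum.inr a) * FreeAlgebra.ι ℂ (Sum.inr b))
  | scalar_right (z : ℂ) : FreeProdRel (FreeAlgebra.ι ℂ (Sum.inr (algebraMap ℂ B z)))
      (algebraMap ℂ _ z)

/-- The free product `C * B` of two unital algebras, with amalgamation over `ℂ`. -/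
abbrev FreeProd : Type (max u w) := RingQuot (FreeProdRel C B)

variable {C B}

/-- The homomorphism `f * g : C * B → D` induced by `f : C → D` and `g : B → D`. -/
def FreeProd.lift {D : Type*} [Ring D] [Algebra ℂ D] (f : C →ₐ[ℂ] D) (g : B →ₐ[ℂ] D) :
    FreeProd C B →ₐ[ℂ] D :=
  RingQuot.liftAlgHom ℂ ⟨FreeAlgebra.lift ℂ (Sum.elim f g), by
    intro x y h
    cases h <;> simp⟩

end FreeProd

section Sequences

variable {C : Type u} [Ring C] [StarRing C] [Algebra ℂ C]
  {A : Type w} [Ring A] [StarRing A] [Algebra ℂ A] [StarModule ℂ A] {ι : Type*}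

/-- The extension `ρ * id : C * B → A` of a unital `*`-homomorphism `ρ : C → A`. -/
def extend (B : StarSubalgebra ℂ A) (ρ : C →⋆ₐ[ℂ] A) : FreeProd C B →ₐ[ℂ] A :=
  FreeProd.lift ρ.toAlgHom B.subtype.toAlgHom

/-- The family `ρ` is identically distributed with respect to `E`: all members have the same
`B`-valued distribution `C * B → B`. -/
def IdentDistribWrt (B : StarSubalgebra ℂ A) (E : A →ₗ[ℂ] B) (ρ : ι → C →⋆ₐ[ℂ] A) : Prop :=
  ∀ i j, ∀ β : FreeProd C B, E (extend B (ρ i) β) = E (extend B (ρ j) β)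

/-- The family `ρ` is freely independent with respect to `E` (free with amalgamation over `B`):
for `k ≥ 1`, indices `i₁ ≠ i₂ ≠ ⋯ ≠ i_k` (neighbours distinct) and `β_l ∈ C * B` with
`E[ρ̃_{i_l}(β_l)] = 0` for all `l`, one has `E[ρ̃_{i₁}(β₁) ⋯ ρ̃_{i_k}(β_k)] = 0`. -/
def FreeWrt (B : StarSubalgebra ℂ A) (E : A →ₗ[ℂ] B) (ρ : ι → C →⋆ₐ[ℂ] A) : Prop :=
  ∀ L : List (ι × FreeProd C B), L ≠ [] → L.IsChain (fun x y => x.1 ≠ y.1) →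
    (∀ x ∈ L, E (extend B (ρ x.1) x.2) = 0) →
    E ((L.map fun x => extend B (ρ x.1) x.2).prod) = 0

/-- The joint distribution `φ_ρ = φ ∘ (ρ₁ * ⋯ * ρ_n)`, a functional on `C_n`. -/
def jointDistribution {n : ℕ} (φ : A →ₗ[ℂ] ℂ) (ρ : Fin n → C →⋆ₐ[ℂ] A) :
    FreePower C n →ₗ[ℂ] ℂ :=
  φ ∘ₗ (LinearAlgebra.FreeProduct.lift ℂ (fun _ : Fin n => C)
    (fun {i} => (ρ i).toAlgHom)).toLinearMap

/-- `(ρ₁, …, ρ_n)` is quantum exchangeable: `φ_ρ` is invariant under the coaction `α_n`, i.e.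
`(φ_ρ ⊗ id) (α_n p) = φ_ρ(p) 1` for all `p ∈ C_n`. -/
def QuantumExchangeable {n : ℕ} (φ : A →ₗ[ℂ] ℂ) (ρ : Fin n → C →⋆ₐ[ℂ] A) : Prop :=
  ∀ p : FreePower C n,
    (slice (jointDistribution φ ρ) (coaction.{u, v} n p) : As.{v} n) =
      jointDistribution φ ρ p • (1 : As.{v} n)

end Sequences

end QuantumPerm

end

/-!
Quantum exchangeability of a family that is free and identically distributed over `B`.

Write `ρ̃_i : C * B → A` for the extension of `ρ_i` by the inclusion of `B`, and let `u` be a magic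
unitary. The map `β ↦ ∑ i, ρ̃_i(β) ⊗ u_{ij}` is a homomorphism `C * B → A ⊗ U` (`twist`), because
the `j`-th column of `u` is a partition of unity. What has to be shown is that `φ ⊗ id` takes the
same value, up to the factor `1`, on a product of twisted letters as `φ` does on the product of the
letters `ρ̃_j(β)` themselves.

Both products are followed at once, in `(A ⊗ U) × A`. Splitting a letter as
`β = (β - E[ρ̃_j(β)]) + E[ρ̃_j(β)]` and merging neighbours with equal index, one sees that every
product lies in the span of `B` and of the products along reduced words, that is, words of centred
letters with neighbouring indices distinct (`diag_mul_mem_reducedSpan`). On `B` the twist does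
nothing. On a reduced word `φ` vanishes by freeness. The twisted product along a reduced word with
indices `j₁, …, j_k` is the sum of `ρ̃_{i₁}(β₁) ⋯ ρ̃_{i_k}(β_k) ⊗ u_{i₁j₁} ⋯ u_{i_kj_k}` over all
`i₁, …, i_k`. If `i_l = i_{l+1}` then `u_{i_lj_l} u_{i_{l+1}j_{l+1}} = 0` by the orthogonality of
the rows, as `j_l ≠ j_{l+1}`; the remaining words are again reduced, the letters being centred for
every index by identical distribution, so `φ` kills them (`prod_twist_mem_span`,
`evalLeft_prod_twist_eq_zero`).
-/

namespace QuantumPerm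

open LinearAlgebra

/-! ### Homomorphisms twisted by a magic unitary -/

section Twist

variable {D : Type*} [Ring D] [Algebra ℂ D] {A : Type*} [Ring A] [Algebra ℂ A]
  {U : Type*} [Ring U] [Algebra ℂ U]

/-- The map `φ ⊗ id : A ⊗ U → U` for a functional `φ` on `A`. -/
def evalLeft (φ : A →ₗ[ℂ] ℂ) : A ⊗[ℂ] U →ₗ[ℂ] U :=
  (TensorProduct.lid ℂ U).toLinearMap ∘ₗ φ.rTensor U

@[simp]
theorem evalLeft_tmul (φ : A →ₗ[ℂ] ℂ) (a : A) (x : U) :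
    evalLeft φ (a ⊗ₜ[ℂ] x) = φ a • x := by
  simp [evalLeft]

variable [StarRing U] {n : ℕ}

/-- The homomorphism `d ↦ ∑ i, f i d ⊗ u i j` obtained from a family of homomorphisms `f` and the
`j`-th column of a magic unitary `u`. It is multiplicative because the entries of a column are
mutually orthogonal idempotents, and unital because they sum to `1`. -/
def twist (f : Fin n → D →ₐ[ℂ] A) {u : Fin n → Fin n → U} (hu : IsMagicUnitary u) (j : Fin n) :
    D →ₐ[ℂ] A ⊗[ℂ] U :=
  AlgHom.ofLinearMap
    (∑ i, ((TensorProduct.mk ℂ A U).flip (u i j)) ∘ₗ (f i).toLinearMap)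
    (by
      simp only [LinearMap.sum_apply, LinearMap.comp_apply, AlgHom.toLinearMap_apply, map_one,
        LinearMap.flip_apply, TensorProduct.mk_apply]
      rw [← TensorProduct.tmul_sum, hu.col_sum j]
      rfl)
    (by
      intro a b
      simp only [LinearMap.sum_apply, LinearMap.comp_apply, AlgHom.toLinearMap_apply, map_mul,
        LinearMap.flip_apply, TensorProduct.mk_apply, Finset.sum_mul, Finset.mul_sum,
        Algebra.TensorProduct.tmul_mul_tmul]
      refine Finset.sum_congr rfl fun i _ => ?_
      rw [Finset.sum_eq_single i]
      · rw [(hu.proj i j).isIdempotentElem.eq]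
      · intro k _ hk
        rw [hu.col_orth j k i hk, TensorProduct.tmul_zero]
      · simp)

theorem twist_apply (f : Fin n → D →ₐ[ℂ] A) {u : Fin n → Fin n → U} (hu : IsMagicUnitary u)
    (j : Fin n) (d : D) : twist f hu j d = ∑ i, f i d ⊗ₜ[ℂ] u i j := by
  simp [twist]

/-- If all `f i` agree at `d`, the twist does nothing, since the columns sum to `1`. -/
theorem twist_apply_of_forall_eq (f : Fin n → D →ₐ[ℂ] A) {u : Fin n → Fin n → U}
    (hu : IsMagicUnitary u) (j : Fin n) {d : D} {a : A} (h : ∀ i, f i d = a) :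
    twist f hu j d = a ⊗ₜ[ℂ] 1 := by
  simp only [twist_apply, h, ← TensorProduct.tmul_sum, hu.col_sum j]

end Twist

/-! ### Generators of the free products -/

section Generators

/-- A subalgebra of `C_n` containing all copies of `C` is everything. -/
theorem mem_of_forall_copy_mem {C : Type*} [Ring C] [Algebra ℂ C] {n : ℕ}
    (S : Subalgebra ℂ (FreePower C n)) (hS : ∀ (j : Fin n) (c : C), copy j c ∈ S)
    (p : FreePower C n) : p ∈ S := by
  let F : FreePower C n →ₐ[ℂ] S :=
    FreeProduct.lift ℂ (fun _ : Fin n => C) (fun {j} => (copy j).codRestrict S (hS j))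
  have h₁ : S.val.comp F = FreeProduct.lift ℂ (fun _ : Fin n => C) (fun {j} => copy j) := by
    refine FreeProduct.lift_unique ℂ (fun _ : Fin n => C) _ _ fun j => ?_
    rw [AlgHom.comp_assoc, FreeProduct.lift_comp_ι]
    rfl
  have h₂ : AlgHom.id ℂ (FreePower C n) =
      FreeProduct.lift ℂ (fun _ : Fin n => C) (fun {j} => copy j) :=
    FreeProduct.lift_unique ℂ (fun _ : Fin n => C) _ _ fun j => rfl
  have h₃ : S.val (F p) = p := DFunLike.congr_fun (h₁.trans h₂.symm) p
  exact h₃ ▸ (F p).2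

theorem lift_copy {C : Type*} [Ring C] [Algebra ℂ C] {D : Type*} [Ring D] [Algebra ℂ D] {n : ℕ}
    (f : Fin n → C →ₐ[ℂ] D) (j : Fin n) (c : C) :
    FreeProduct.lift ℂ (fun _ : Fin n => C) (fun {i} => f i) (copy j c) = f j c :=
  DFunLike.congr_fun (FreeProduct.lift_comp_ι ℂ (fun _ : Fin n => C)
    (fun {i} => f i) (i := j)) c

variable {C : Type*} [Ring C] [Algebra ℂ C] {B : Type*} [Ring B] [Algebra ℂ B]

/-- The image of `c : C` in `C * B`. -/
def FreeProd.inl (c : C) : FreeProd C B :=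
  RingQuot.mkAlgHom ℂ (FreeProdRel C B) (FreeAlgebra.ι ℂ (Sum.inl c))

/-- The image of `b : B` in `C * B`. -/
def FreeProd.inr (b : B) : FreeProd C B :=
  RingQuot.mkAlgHom ℂ (FreeProdRel C B) (FreeAlgebra.ι ℂ (Sum.inr b))

@[simp]
theorem FreeProd.lift_inl {D : Type*} [Ring D] [Algebra ℂ D] (f : C →ₐ[ℂ] D) (g : B →ₐ[ℂ] D)
    (c : C) : FreeProd.lift f g (FreeProd.inl c) = f c := by
  simp [FreeProd.lift, FreeProd.inl]

@[simp]
theorem FreeProd.lift_inr {D : Type*} [Ring D] [Algebra ℂ D] (f : C →ₐ[ℂ] D) (g : B →ₐ[ℂ] D)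
    (b : B) : FreeProd.lift f g (FreeProd.inr b) = g b := by
  simp [FreeProd.lift, FreeProd.inr]

end Generators

/-! ### Reduced words -/

section Words

variable {C : Type*} [Ring C] [StarRing C] [Algebra ℂ C]
  {A : Type*} [Ring A] [StarRing A] [Algebra ℂ A] [StarModule ℂ A]
  {B : StarSubalgebra ℂ A} {E : A →ₗ[ℂ] B}

@[simp]
theorem extend_inl (ρ : C →⋆ₐ[ℂ] A) (c : C) : extend B ρ (FreeProd.inl c) = ρ c :=
  FreeProd.lift_inl _ _ c

@[simp]
theorem extend_inr (ρ : C →⋆ₐ[ℂ] A) (b : B) : extend B ρ (FreeProd.inr b) = b :=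
  FreeProd.lift_inr _ _ b

theorem IsCondExp.apply_coe (hE : IsCondExp B E) (b : B) : E (b : A) = b := by
  simpa [hE.map_one] using hE.bimodule b 1 1

theorem IsCondExp.apply_coe_mul (hE : IsCondExp B E) (b : B) (a : A) :
    E ((b : A) * a) = b * E a := by
  simpa using hE.bimodule b 1 a

/-- A reduced word: a nonempty list of pairs `(j, β)` with neighbouring indices distinct and each
letter centred, `E[ρ̃_j(β)] = 0`. Freeness says that `E` vanishes on its product. -/
structure IsReducedWord {ι : Type*} (B : StarSubalgebra ℂ A) (E : A →ₗ[ℂ] B)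
    (ρ : ι → C →⋆ₐ[ℂ] A) (L : List (ι × FreeProd C B)) : Prop where
  ne_nil : L ≠ []
  isChain : L.IsChain (fun x y => x.1 ≠ y.1)
  centred : ∀ x ∈ L, E (extend B (ρ x.1) x.2) = 0

namespace IsReducedWord

variable {ι : Type*} {ρ : ι → C →⋆ₐ[ℂ] A} {j : ι} {β : FreeProd C B}
  {L : List (ι × FreeProd C B)}

theorem singleton (h : E (extend B (ρ j) β) = 0) : IsReducedWord B E ρ [(j, β)] :=
  ⟨by simp, by simp, by simpa using h⟩

theorem cons {i : ι} {γ : FreeProd C B} (hL : IsReducedWord B E ρ ((i, γ) :: L)) (hij : j ≠ i)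
    (h : E (extend B (ρ j) β) = 0) : IsReducedWord B E ρ ((j, β) :: (i, γ) :: L) :=
  ⟨by simp, List.isChain_cons_cons.2 ⟨hij, hL.isChain⟩, List.forall_mem_cons.2 ⟨h, hL.centred⟩⟩

theorem head (hL : IsReducedWord B E ρ ((j, β) :: L)) : E (extend B (ρ j) β) = 0 :=
  hL.centred (j, β) (by simp)

/-- The first letter of a reduced word may be replaced, keeping its index. -/
theorem replace_head {γ : FreeProd C B} (hL : IsReducedWord B E ρ ((j, β) :: L))
    (h : E (extend B (ρ j) γ) = 0) : IsReducedWord B E ρ ((j, γ) :: L) := by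
  refine ⟨by simp, ?_, List.forall_mem_cons.2 ⟨h, (List.forall_mem_cons.1 hL.centred).2⟩⟩
  cases L with
  | nil => simp
  | cons x L => exact List.isChain_cons_cons.2 (List.isChain_cons_cons.1 hL.isChain)

theorem tail {x : ι × FreeProd C B} (hL : IsReducedWord B E ρ ((j, β) :: x :: L)) :
    j ≠ x.1 ∧ IsReducedWord B E ρ (x :: L) :=
  ⟨(List.isChain_cons_cons.1 hL.isChain).1, by simp, (List.isChain_cons_cons.1 hL.isChain).2,
    (List.forall_mem_cons.1 hL.centred).2⟩

theorem apply_prod_eq_zero (hL : IsReducedWord B E ρ L) (hfree : FreeWrt B E ρ)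
    {φ : A →ₗ[ℂ] ℂ} (hEφ : ∀ a : A, φ (E a : A) = φ a) :
    φ (L.map fun x => extend B (ρ x.1) x.2).prod = 0 := by
  rw [← hEφ, hfree L hL.ne_nil hL.isChain hL.centred]
  simp

end IsReducedWord

variable {U : Type*} [Ring U] [StarRing U] [Algebra ℂ U] {n : ℕ} {ρ : Fin n → C →⋆ₐ[ℂ] A}
  {u : Fin n → Fin n → U}

/-- The twisted product along a reduced word `(j₁, β₁), …, (j_k, β_k)` is a combination of products
`ρ̃_{i₁}(β₁) ⋯ ρ̃_{i_k}(β_k) ⊗ u_{i₁j₁} ⋯ u_{i_kj_k}` along reduced words: neighbouring `j`s are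
distinct, so the orthogonality of each row of `u` removes the terms with equal neighbouring `i`s.
The common head factor `u_{i₁j₁}` is recorded for the induction. -/
theorem prod_twist_mem_span (hu : IsMagicUnitary u) (hid : IdentDistribWrt B E ρ)
    (L : List (Fin n × FreeProd C B)) (j : Fin n) (β : FreeProd C B)
    (hL : IsReducedWord B E ρ ((j, β) :: L)) :
    (((j, β) :: L).map fun x => twist (fun i => extend B (ρ i)) hu x.1 x.2).prod ∈
      Submodule.span ℂ {t : A ⊗[ℂ] U | ∃ (i : Fin n) (γ : FreeProd C B)
        (M : List (Fin n × FreeProd C B)) (v : U), IsReducedWord B E ρ ((i, γ) :: M) ∧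
          t = (((i, γ) :: M).map fun x => extend B (ρ x.1) x.2).prod ⊗ₜ[ℂ] (u i j * v)} := by
  induction L generalizing j β with
  | nil =>
    simp only [List.map_cons, List.map_nil, List.prod_cons, List.prod_nil, mul_one, twist_apply]
    refine Submodule.sum_mem _ fun i _ => Submodule.subset_span ⟨i, β, [], 1, ?_, by simp⟩
    exact .singleton ((hid i j β).trans hL.head)
  | cons x L ih =>
    obtain ⟨j', β'⟩ := x
    obtain ⟨hj, hL'⟩ := hL.tail
    rw [List.map_cons, List.prod_cons]
    refine Submodule.span_induction (fun t ht => ?_) (by simp)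
      (fun s t _ _ hs ht => by rw [mul_add]; exact add_mem hs ht)
      (fun z t _ ht => by rw [mul_smul_comm]; exact Submodule.smul_mem _ z ht) (ih j' β' hL')
    obtain ⟨i', γ, M, v, hM, rfl⟩ := ht
    rw [twist_apply, Finset.sum_mul]
    refine Submodule.sum_mem _ fun i _ => ?_
    rw [Algebra.TensorProduct.tmul_mul_tmul, ← mul_assoc]
    by_cases hi : i = i'
    · subst hi
      rw [hu.row_orth i j j' hj, zero_mul, TensorProduct.tmul_zero]
      exact zero_mem _
    · refine Submodule.subset_span ⟨i, β, (i', γ) :: M, u i' j' * v,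
        hM.cons hi ((hid i j β).trans hL.head), ?_⟩
      rw [mul_assoc, List.map_cons (l := (i', γ) :: M), List.prod_cons]

theorem evalLeft_prod_twist_eq_zero (hu : IsMagicUnitary u) (hfree : FreeWrt B E ρ)
    (hid : IdentDistribWrt B E ρ) {φ : A →ₗ[ℂ] ℂ} (hEφ : ∀ a : A, φ (E a : A) = φ a)
    {L : List (Fin n × FreeProd C B)} (hL : IsReducedWord B E ρ L) :
    evalLeft φ (L.map fun x => twist (fun i => extend B (ρ i)) hu x.1 x.2).prod = 0 := by
  obtain _ | ⟨⟨j, β⟩, L⟩ := L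
  · exact absurd rfl hL.ne_nil
  refine Submodule.span_induction (p := fun t _ => evalLeft φ t = 0) ?_ (map_zero _)
    (fun s t _ _ hs ht => by rw [map_add, hs, ht, add_zero])
    (fun z t _ ht => by rw [map_smul, ht, smul_zero]) (prod_twist_mem_span hu hid L j β hL)
  rintro _ ⟨i, γ, M, v, hM, rfl⟩
  rw [evalLeft_tmul, hM.apply_prod_eq_zero hfree hEφ, zero_smul]

/-! ### The span of the reduced words -/

/-- The homomorphism `β ↦ (∑ i, ρ̃_i(β) ⊗ u_{ij}, ρ̃_j(β))`, which follows an element of `C * B`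
through the twisted and the untwisted algebra at once. -/
def diag (B : StarSubalgebra ℂ A) (ρ : Fin n → C →⋆ₐ[ℂ] A) (hu : IsMagicUnitary u) (j : Fin n) :
    FreeProd C B →ₐ[ℂ] (A ⊗[ℂ] U) × A :=
  (twist (fun i => extend B (ρ i)) hu j).prod (extend B (ρ j))

theorem diag_apply (hu : IsMagicUnitary u) (j : Fin n) (β : FreeProd C B) :
    diag B ρ hu j β = (twist (fun i => extend B (ρ i)) hu j β, extend B (ρ j) β) :=
  rfl

theorem diag_inr (hu : IsMagicUnitary u) (j : Fin n) (b : B) :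
    diag B ρ hu j (FreeProd.inr b) = ((b : A) ⊗ₜ[ℂ] 1, (b : A)) := by
  rw [diag_apply, twist_apply_of_forall_eq _ hu j fun i => extend_inr (ρ i) b, extend_inr]

/-- The span of `B` and of the products along reduced words, in the twisted and the untwisted
algebra at once. -/
def reducedSpan (B : StarSubalgebra ℂ A) (E : A →ₗ[ℂ] B) (ρ : Fin n → C →⋆ₐ[ℂ] A)
    (hu : IsMagicUnitary u) : Submodule ℂ ((A ⊗[ℂ] U) × A) :=
  Submodule.span ℂ (Set.range (fun b : B => ((b : A) ⊗ₜ[ℂ] 1, (b : A))) ∪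
    {x | ∃ L, IsReducedWord B E ρ L ∧ x = (L.map fun x => diag B ρ hu x.1 x.2).prod})

theorem coe_mem_reducedSpan (hu : IsMagicUnitary u) (b : B) :
    ((b : A) ⊗ₜ[ℂ] 1, (b : A)) ∈ reducedSpan B E ρ hu :=
  Submodule.subset_span (.inl ⟨b, rfl⟩)

theorem IsReducedWord.prod_diag_mem {L : List (Fin n × FreeProd C B)}
    (hL : IsReducedWord B E ρ L) (hu : IsMagicUnitary u) :
    (L.map fun x => diag B ρ hu x.1 x.2).prod ∈ reducedSpan B E ρ hu :=
  Submodule.subset_span (.inr ⟨L, hL, rfl⟩)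

theorem exists_centred_add (hE : IsCondExp B E) (ρ : C →⋆ₐ[ℂ] A) (γ : FreeProd C B) :
    ∃ (γ₀ : FreeProd C B) (b : B), γ = γ₀ + FreeProd.inr b ∧ E (extend B ρ γ₀) = 0 :=
  ⟨γ - FreeProd.inr (E (extend B ρ γ)), E (extend B ρ γ), by simp, by
    simp [hE.apply_coe]⟩

theorem diag_mem_reducedSpan (hE : IsCondExp B E) (hu : IsMagicUnitary u) (j : Fin n)
    (γ : FreeProd C B) : diag B ρ hu j γ ∈ reducedSpan B E ρ hu := by
  obtain ⟨γ₀, b, rfl, hγ₀⟩ := exists_centred_add hE (ρ j) γ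
  rw [map_add, diag_inr]
  refine add_mem ?_ (coe_mem_reducedSpan hu b)
  simpa using (IsReducedWord.singleton hγ₀).prod_diag_mem hu

/-- The scalar part of a letter prepended to a reduced word is absorbed in the next letter, which
stays centred because `E` is left `B`-linear. -/
theorem diag_mul_prod_mem (hE : IsCondExp B E) (hu : IsMagicUnitary u) {i j : Fin n}
    (γ β : FreeProd C B) {L : List (Fin n × FreeProd C B)}
    (hL : IsReducedWord B E ρ ((i, β) :: L)) (hij : j ≠ i) :
    diag B ρ hu j γ * (((i, β) :: L).map fun x => diag B ρ hu x.1 x.2).prod ∈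
      reducedSpan B E ρ hu := by
  obtain ⟨γ₀, b, rfl, hγ₀⟩ := exists_centred_add hE (ρ j) γ
  rw [map_add, add_mul]
  refine add_mem ?_ ?_
  · simpa only [List.map_cons, List.prod_cons] using (hL.cons hij hγ₀).prod_diag_mem hu
  · have h : E (extend B (ρ i) (FreeProd.inr b * β)) = 0 := by
      rw [map_mul, extend_inr, hE.apply_coe_mul, hL.head, mul_zero]
    rw [diag_inr, ← diag_inr (ρ := ρ) hu i b]
    simpa only [List.map_cons, List.prod_cons, map_mul, mul_assoc] using
      (hL.replace_head h).prod_diag_mem hu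

theorem diag_mul_mem_reducedSpan (hE : IsCondExp B E) (hu : IsMagicUnitary u) (j : Fin n)
    (γ : FreeProd C B) {x : (A ⊗[ℂ] U) × A} (hx : x ∈ reducedSpan B E ρ hu) :
    diag B ρ hu j γ * x ∈ reducedSpan B E ρ hu := by
  refine Submodule.span_induction (fun x hx => ?_) (by simp)
    (fun s t _ _ hs ht => by rw [mul_add]; exact add_mem hs ht)
    (fun z t _ ht => by rw [mul_smul_comm]; exact Submodule.smul_mem _ z ht) hx
  rcases hx with ⟨b, rfl⟩ | ⟨L, hL, rfl⟩
  · dsimp only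
    rw [← diag_inr (ρ := ρ) hu j b, ← map_mul]
    exact diag_mem_reducedSpan hE hu j _
  · obtain _ | ⟨⟨i, β⟩, L⟩ := L
    · exact absurd rfl hL.ne_nil
    by_cases hij : j = i
    -- Equal indices: the two letters merge, and the rest of the word starts with another index.
    · subst hij
      rw [List.map_cons, List.prod_cons, ← mul_assoc, ← map_mul]
      obtain _ | ⟨⟨k, δ⟩, L⟩ := L
      · simpa using diag_mem_reducedSpan hE hu j (γ * β)
      · exact diag_mul_prod_mem hE hu _ δ hL.tail.2 hL.tail.1
    · exact diag_mul_prod_mem hE hu γ β hL hij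

/-- On the span of the reduced words, `φ ⊗ id` of the first component is `φ` of the second: both
sides vanish on reduced words and agree on `B`. -/
theorem evalLeft_fst_eq_of_mem_reducedSpan (hu : IsMagicUnitary u) (hfree : FreeWrt B E ρ)
    (hid : IdentDistribWrt B E ρ) {φ : A →ₗ[ℂ] ℂ} (hEφ : ∀ a : A, φ (E a : A) = φ a)
    {x : (A ⊗[ℂ] U) × A} (hx : x ∈ reducedSpan B E ρ hu) :
    evalLeft φ x.1 = φ x.2 • (1 : U) := by
  refine Submodule.span_induction (p := fun x _ => evalLeft φ x.1 = φ x.2 • (1 : U))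
    (fun x hx => ?_) (by simp)
    (fun s t _ _ hs ht => by simp only [Prod.fst_add, Prod.snd_add, map_add, hs, ht, add_smul])
    (fun z t _ ht => by simp only [Prod.smul_fst, Prod.smul_snd, map_smul, ht, smul_assoc]) hx
  rcases hx with ⟨b, rfl⟩ | ⟨L, hL, rfl⟩
  · exact evalLeft_tmul φ _ _
  · have h₁ : (L.map fun x => diag B ρ hu x.1 x.2).prod.1 =
        (L.map fun x => twist (fun i => extend B (ρ i)) hu x.1 x.2).prod := by
      have := map_list_prod (RingHom.fst (A ⊗[ℂ] U) A) (L.map fun x => diag B ρ hu x.1 x.2)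
      rwa [List.map_map] at this
    have h₂ : (L.map fun x => diag B ρ hu x.1 x.2).prod.2 =
        (L.map fun x => extend B (ρ x.1) x.2).prod := by
      have := map_list_prod (RingHom.snd (A ⊗[ℂ] U) A) (L.map fun x => diag B ρ hu x.1 x.2)
      rwa [List.map_map] at this
    rw [h₁, h₂, evalLeft_prod_twist_eq_zero hu hfree hid hEφ hL,
      hL.apply_prod_eq_zero hfree hEφ, zero_smul]

/-- A homomorphism from `C_n` that sends `c^{(j)}` to `(∑ i, ρ_i(c) ⊗ u_{ij}, ρ_j(c))` takes values
in the span of the reduced words. -/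
theorem mem_reducedSpan_of_apply_copy (hE : IsCondExp B E) (hu : IsMagicUnitary u)
    (G : FreePower C n →ₐ[ℂ] (A ⊗[ℂ] U) × A)
    (hG : ∀ j c, G (copy j c) = diag B ρ hu j (FreeProd.inl c)) (p : FreePower C n) :
    G p ∈ reducedSpan B E ρ hu := by
  let S : Subalgebra ℂ (FreePower C n) :=
    { carrier := {p | ∀ x ∈ reducedSpan B E ρ hu, G p * x ∈ reducedSpan B E ρ hu}
      mul_mem' := fun {p q} hp hq x hx => by
        rw [map_mul, mul_assoc]
        exact hp _ (hq _ hx)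
      add_mem' := fun {p q} hp hq x hx => by
        rw [map_add, add_mul]
        exact add_mem (hp _ hx) (hq _ hx)
      algebraMap_mem' := fun z x hx => by
        rw [AlgHom.commutes, ← Algebra.smul_def]
        exact Submodule.smul_mem _ z hx }
  have hp : p ∈ S := mem_of_forall_copy_mem S (fun j c x hx => by
    rw [hG]
    exact diag_mul_mem_reducedSpan hE hu j _ hx) p
  have h1 : (1 : (A ⊗[ℂ] U) × A) ∈ reducedSpan B E ρ hu := by
    have h := coe_mem_reducedSpan (E := E) (ρ := ρ) hu (1 : B)
    exact h
  simpa using hp 1 h1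

end Words

end QuantumPerm

theorem mainTheorem4 {C : Type u} [Ring C] [StarRing C] [Algebra ℂ C] [StarModule ℂ C]
    {A : Type w} [Ring A] [StarRing A] [Algebra ℂ A] [StarModule ℂ A]
    (φ : A →ₗ[ℂ] ℂ) (hφ : QuantumPerm.IsState φ)
    (n : ℕ) (ρ : Fin n → C →⋆ₐ[ℂ] A)
    (B : StarSubalgebra ℂ A) (E : A →ₗ[ℂ] B)
    (hE : QuantumPerm.IsCondExp B E) (hEφ : ∀ a : A, φ (E a : A) = φ a)
    (hfree : QuantumPerm.FreeWrt B E ρ) (hid : QuantumPerm.IdentDistribWrt B E ρ) :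
    QuantumPerm.QuantumExchangeable.{u, v, w} φ ρ := by
  intro p
  let Λ : QuantumPerm.FreePower C n →ₐ[ℂ] A :=
    LinearAlgebra.FreeProduct.lift ℂ (fun _ : Fin n => C) (fun {i} => (ρ i).toAlgHom)
  have hΛ : ∀ j c, Λ (QuantumPerm.copy j c) = ρ j c :=
    QuantumPerm.lift_copy fun i => (ρ i).toAlgHom
  let T : QuantumPerm.FreePower C n ⊗[ℂ] QuantumPerm.denseAlg.{v} n →ₐ[ℂ]
      A ⊗[ℂ] QuantumPerm.denseAlg.{v} n := Algebra.TensorProduct.map Λ (AlgHom.id ℂ _)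
  have hslice : ∀ t, QuantumPerm.slice (QuantumPerm.jointDistribution φ ρ) t =
      QuantumPerm.evalLeft φ (T t) := by
    intro t
    induction t with
    | zero => simp
    | tmul q a =>
      rw [QuantumPerm.slice_tmul, Algebra.TensorProduct.map_tmul, QuantumPerm.evalLeft_tmul]
      rfl
    | add s t hs ht => rw [map_add, map_add, map_add, hs, ht]
  have hmem := QuantumPerm.mem_reducedSpan_of_apply_copy (ρ := ρ) hE
    (QuantumPerm.denseGen_magic.{v} n) ((T.comp (QuantumPerm.coaction.{u, v} n)).prod Λ)
    (fun j c => by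
      rw [AlgHom.prod_apply, AlgHom.comp_apply, QuantumPerm.coaction_copy, map_sum,
        QuantumPerm.diag_apply, QuantumPerm.twist_apply, QuantumPerm.extend_inl, hΛ]
      simp only [T, Algebra.TensorProduct.map_tmul, hΛ, AlgHom.id_apply,
        QuantumPerm.extend_inl]) p
  have h := QuantumPerm.evalLeft_fst_eq_of_mem_reducedSpan _ hfree hid hEφ hmem
  rw [hslice]
  exact congrArg Subtype.val h
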